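/- Notation. Cardinals are identified with their initial ordinals. For a set $C$ of ordinals let $\mathrm{nacc}(C)$ be the set of those $\gamma\in C$ which are not accumulation points of $C$, i.e. it is not the case that $\gamma$ is a limit ordinal with $\sup(C\cap\gamma)=\gamma$. For an ideal $I$ on a set $S$, a subset of $S$ is called $I$-positive if it is not in $I$. For an ideal $I$ on a set $S$ and a cardinal $\chi$, let $\mathbf U_I(\chi)$ be the least cardinality of a family $\mathcal P$ of subsets of $\chi$, each of cardinality at most $|S|$, such that for every $f:S\to\chi$ there is $u\in\mathcal P$ for which $\{s\in S: f(s)\in u\}$ is $I$-positive. Let $\lambda$ be a regular uncountable cardinal and $\chi_2>\chi_1\ge\lambda$ cardinals. $\mathrm{Qr}_1(\chi_2,\chi_1,\lambda)$ means that there are a set $S\subseteq\lambda$, an ideal $I$ on $S$, sets $C_\delta\subseteq\delta$ ($\delta\in S$), functions $g_{j,\delta}:C_\delta\to\{0,1\}$ and families $\mathcal A_{j,\delta}\subseteq\mathcal P(\mathrm{nacc}(C_\delta))$ ($j<\chi_2$, $\delta\in S$) such that: (1) $\mathbf U_I(\chi_1)<\chi_2$, where if $\chi_1=\lambda$ one stipulates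 $\mathbf U_I(\chi_1)=\chi_1$ (so that then (1) just says $\chi_1<\chi_2$); (2) if $j_1\ne j_2$, $\delta\in S$, $A_1\in\mathcal A_{j_1,\delta}$ and $A_2\in\mathcal A_{j_2,\delta}$, then there is $\gamma\in A_1\cap A_2$ with $g_{j_1,\delta}(\gamma)\ne g_{j_2,\delta}(\gamma)$; (3) for every $j<\chi_2$ and every club $E$ of $\lambda$ there is an $I$-positive set $Y\subseteq S$ such that $\mathrm{nacc}(C_\delta)\cap E\in\mathcal A_{j,\delta}$ for every $\delta\in Y$; moreover, if $\chi_1>\lambda$, then $Y$ can be chosen with $S\setminus Y\in I$ (equivalently, every $I$-positive set contains some $\delta$ with $\mathrm{nacc}(C_\delta)\cap E\in\mathcal A_{j,\delta}$). Theorem. Let $\lambda$ be a regular uncountable cardinal, let $\chi_2>\chi_1\ge\lambda$ be cardinals, and assume $\mathrm{Qr}_1(\chi_2,\chi_1,\lambda)$. Then there is no sequence $\langle G_\alpha:\alpha<\alpha_*\rangle$ of length $\alpha_*<\chi_2$ of groups, each of cardinality at most $\chi_1$, such that every locally finite group $H$ of cardinality $\lambda$ can be embedded into at least one $G_\alpha$.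 -/

import Mathlib

open Cardinal Ordinal Order

universe u

/-- The non-accumulation points of a set `C`: those `γ ∈ C` that are not limit points of `C`,
i.e. it is not the case that `γ` is a limit element and `C ∩ γ` is cofinal below `γ`. -/
def nacc {L : Type u} [LinearOrder L] (C : Set L) : Set L :=
  {γ ∈ C | ¬ (IsSuccLimit γ ∧ ∀ β < γ, ∃ α ∈ C, β < α ∧ α < γ)}

/-- `uNumber J B` is the cardinal `U_J(B)` of an ideal `J` on a set `A`: the least size of a family
`P` of subsets of `B`, each of cardinality at most `|A|`, such that for every `f : A → B` there is
`u ∈ P` for which `{a | f a ∈ u}` is `J`-positive.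
If `J` is a proper ideal then such families exist (all subsets of size at most `|A|`), and the
infimum is attained since cardinals are well-ordered. -/
noncomputable def uNumber {A : Type u} (J : Ideal (Set A)) (B : Type u) : Cardinal.{u} :=
  sInf {c | ∃ P : Set (Set B), #P = c ∧ (∀ v ∈ P, #v ≤ #A) ∧
    ∀ f : A → B, ∃ v ∈ P, {a | f a ∈ v} ∉ J}

/-- A witness to `Qr₁(χ₂, χ₁, κ)`. The cardinals `κ`, `χ₁`, `χ₂` are represented by the
well-orders `κ.ord.ToType` etc. of the ordinals below them. A set `X ⊆ S` is positive if it does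
not belong to `I`. -/
structure QrOneWitness (χ₂ χ₁ κ : Cardinal.{u}) where
  /-- a subset `S` of `κ` -/
  S : Set κ.ord.ToType
  /-- an ideal on `S` -/
  I : Ideal (Set S)
  /-- the sets `C_δ ⊆ δ`, for `δ ∈ S` -/
  C : S → Set κ.ord.ToType
  C_lt : ∀ δ : S, ∀ γ ∈ C δ, γ < δ.1
  /-- the functions `g_{j,δ} : C_δ → {0, 1}` -/
  g : χ₂.ord.ToType → ∀ δ : S, C δ → Fin 2
  /-- the families `𝒜_{j,δ}` of subsets of `nacc C_δ` -/
  𝒜 : χ₂.ord.ToType → S → Set (Set κ.ord.ToType)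
  𝒜_sub : ∀ j δ, ∀ A ∈ 𝒜 j δ, A ⊆ nacc (C δ)
  /-- `U_I(χ₁) < χ₂`, where for `χ₁ = κ` one stipulates `U_I(χ₁) = χ₁`, so that the
  condition becomes `χ₁ < χ₂`. -/
  u_lt : (χ₁ = κ ∧ χ₁ < χ₂) ∨ (χ₁ ≠ κ ∧ uNumber I χ₁.ord.ToType < χ₂)
  differ : ∀ j₁ j₂, j₁ ≠ j₂ → ∀ δ : S, ∀ A₁ ∈ 𝒜 j₁ δ, ∀ A₂ ∈ 𝒜 j₂ δ,
    ∃ γ : C δ, γ.1 ∈ A₁ ∩ A₂ ∧ g j₁ δ γ ≠ g j₂ δ γ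
  /-- Club guessing: for every `j` and every club `E` of `κ`, the guessing `nacc C_δ ∩ E ∈ 𝒜_{j,δ}`
  takes place for all `δ` in some positive set `Y`; if `χ₁ ≠ κ` (the case where `I` is linked to
  `χ₁` through `U_I(χ₁)`), it takes place for `I`-almost all `δ`; equivalently, every positive
  set contains a `δ` for which it takes place. -/
  guess : ∀ j, ∀ E : Set κ.ord.ToType, IsClub E →
    ∃ Y : Set S, Y ∉ I ∧ (χ₁ ≠ κ → Yᶜ ∈ I) ∧ ∀ δ ∈ Y, nacc (C δ) ∩ E ∈ 𝒜 j δ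

/-- `Qr₁(χ₂, χ₁, κ)`, to be used for `κ` regular uncountable and `κ ≤ χ₁ < χ₂`. -/
def QrOne (χ₂ χ₁ κ : Cardinal.{u}) : Prop :=
  Nonempty (QrOneWitness χ₂ χ₁ κ)

/-- A group is locally finite if all its finitely generated subgroups are finite. -/
def IsLocallyFiniteGroup (H : Type u) [Group H] : Prop :=
  ∀ K : Subgroup H, K.FG → Finite K

/-! ### Coding binary relations in locally finite groups. -/

open scoped commutatorElement

/-! For each `j`, let the bit at `(δ, α)` be the value of `g_{j,δ}` at the next point of `C_δ` above
`α`. This relation is coded in a locally finite group of size `κ` by conditions that survive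
embeddings (`exists_locallyFinite_codingSystem`). If fewer than `χ₂` groups were universal, a
pigeonhole on the target group, on `δ` and on the tuple at `δ` (caught by `exists_family` in one of
fewer than `χ₂` sets of size at most `κ`) would give `j₁ ≠ j₂` coded in one group with equal tuples
at `δ`.

The two guessed sets then share a `γ ∈ nacc C_δ`, lying in both reflecting clubs, where the two `g`
differ. Just below `γ` the coded bits are constant and opposite. Reflection gives `u < w` and `v`
there such that `q v` of the system with bit 1 commutes with `p u` and `r w` of the other.
Conjugation by `q v` fixes `⁅p u, r w⁆` and sends the common `t δ` to the common `s δ`; but the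
commutator commutes with `t δ` and not with `s δ`. -/

/-- Elements of `H` indexed by a linear order `L`, satisfying relations that encode the binary
relation `F` on `L` and are preserved by all group embeddings. -/
structure CodingSystem {L : Type*} [LinearOrder L] (F : L → L → Prop) (H : Type*) [Group H] where
  p : L → H
  r : L → H
  q : L → H
  t : L → H
  s : L → H
  commute_q_p : ∀ ⦃β α⦄, β < α → Commute (q α) (p β)
  commute_q_r : ∀ ⦃α δ⦄, α < δ → Commute (q α) (r δ)
  conj_t : ∀ ⦃α ε⦄, α < ε → F ε α → q α * t ε * (q α)⁻¹ = s ε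
  commute_t : ∀ ⦃β δ ε⦄, β < δ → δ < ε → (∀ α, β ≤ α → α ≤ δ → ¬ F ε α) → Commute ⁅p β, r δ⁆ (t ε)
  not_commute_s : ∀ ⦃β δ ε⦄, β < δ → δ < ε → (∀ α, β ≤ α → α ≤ δ → ¬ F ε α) →
    ¬ Commute ⁅p β, r δ⁆ (s ε)

/-- All elements of a coding system with a given index. -/
def CodingSystem.tuple {L : Type*} [LinearOrder L] {F : L → L → Prop} {H : Type*} [Group H]
    (x : CodingSystem F H) (a : L) : H × H × H × H × H :=
  (x.p a, x.r a, x.q a, x.t a, x.s a)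

/-- The image of a coding system under a group embedding. -/
def CodingSystem.map {L : Type*} [LinearOrder L] {F : L → L → Prop} {H G : Type*} [Group H]
    [Group G] (x : CodingSystem F H) (f : H →* G) (hf : Function.Injective f) :
    CodingSystem F G where
  p := f ∘ x.p
  r := f ∘ x.r
  q := f ∘ x.q
  t := f ∘ x.t
  s := f ∘ x.s
  commute_q_p _ _ h := (x.commute_q_p h).map f
  commute_q_r _ _ h := (x.commute_q_r h).map f
  conj_t _ _ h h' := by simp [← x.conj_t h h']
  commute_t _ _ _ h h' h'' := by
    have := (x.commute_t h h' h'').map f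
    rwa [map_commutatorElement] at this
  not_commute_s _ _ _ h h' h'' hc := by
    refine x.not_commute_s h h' h'' (hf ?_)
    simpa [← map_commutatorElement, Commute, SemiconjBy] using hc

/-- A subgroup of a power of a finite group is locally finite. -/
theorem isLocallyFiniteGroup_subgroup_pi {X : Type u} {K : Type} [Group K] [Finite K]
    (H : Subgroup (X → K)) : IsLocallyFiniteGroup H := by
  intro N hN
  obtain ⟨T, rfl⟩ := hN
  -- Coordinates on which all generators agree are identified; finitely many classes remain, and
  -- they determine every element of the closure.
  let res : X → (T → K) := fun x g => g.1.1 x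
  have hfin : Finite (Set.range res) := inferInstance
  have key : ∀ g ∈ Subgroup.closure (T : Set H), ∀ x y, res x = res y → g.1 x = g.1 y := by
    intro g hg x y hxy
    induction hg using Subgroup.closure_induction with
    | mem g hg => exact congrFun hxy ⟨g, hg⟩
    | one => rfl
    | mul a b _ _ ha hb => simp [ha, hb]
    | inv a _ ha => simp [ha]
  choose sec hsec using fun c : Set.range res => c.2
  refine Finite.of_injective (β := Set.range res → K) (fun g c => g.1.1 (sec c)) ?_
  intro a b hab
  refine Subtype.ext (Subtype.ext (funext fun x => ?_))
  have h := congrFun hab ⟨res x, x, rfl⟩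
  have hx := hsec ⟨res x, x, rfl⟩
  rw [← key a.1 a.2 _ _ hx, ← key b.1 b.2 _ _ hx]
  exact h

/-- A coding system in the symmetric group of degree four, all of whose instances of
`not_commute_s` but one may fail. -/
theorem exists_coding_in_perm {L : Type*} [LinearOrder L] (F : L → L → Prop) (b₀ d₀ e₀ : L)
    (hβδ : b₀ < d₀) (hF : ∀ α, b₀ ≤ α → α ≤ d₀ → ¬ F e₀ α) :
    ∃ p r q t s : L → Equiv.Perm (Fin 4),
      (∀ β α, β < α → Commute (q α) (p β)) ∧
      (∀ α δ, α < δ → Commute (q α) (r δ)) ∧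
      (∀ α ε, α < ε → F ε α → q α * t ε * (q α)⁻¹ = s ε) ∧
      (∀ β δ ε, Commute ⁅p β, r δ⁆ (t ε)) ∧
      ¬ Commute ⁅p b₀, r d₀⁆ (s e₀) := by
  classical
  let r₀ : Equiv.Perm (Fin 4) := Equiv.swap 0 1 * Equiv.swap 1 2
  let p₀ : Equiv.Perm (Fin 4) := Equiv.swap 2 3
  let x₀ : Equiv.Perm (Fin 4) := Equiv.swap 0 1 * Equiv.swap 2 3
  have h1 : Commute x₀ p₀ := by unfold Commute SemiconjBy; decide
  have h2 : x₀ * ⁅p₀, r₀⁆ * x₀⁻¹ = r₀⁻¹ * ⁅p₀, r₀⁆ * r₀ := by decide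
  have h3 : ¬ Commute ⁅p₀, r₀⁆ (r₀⁻¹ * ⁅p₀, r₀⁆ * r₀) := by unfold Commute SemiconjBy; decide
  -- The value `q α` must commute with `p₀` if `α > b₀` and with `r₀` if `α < d₀`. Both apply only
  -- strictly between `b₀` and `d₀`, where `F e₀ α` fails and `1` suffices. On either side, `r₀⁻¹`
  -- or `x₀` meets the one remaining demand, and both conjugate `⁅p₀, r₀⁆` to the same element.
  refine ⟨fun β => if β = b₀ then p₀ else 1, fun δ => if δ = d₀ then r₀ else 1,
    fun α => if α ≤ b₀ then r₀⁻¹ else if α < d₀ then 1 else x₀,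
    fun ε => if ε = e₀ then ⁅p₀, r₀⁆ else 1,
    fun ε => if ε = e₀ then r₀⁻¹ * ⁅p₀, r₀⁆ * r₀ else 1, ?_, ?_, ?_, ?_, ?_⟩
  · intro β α h
    by_cases hβ : β = b₀
    · subst hβ
      simp only [h.not_ge, if_false, if_true]
      split_ifs
      · exact .one_left _
      · exact h1
    · simp [hβ]
  · intro α δ h
    by_cases hδ : δ = d₀
    · subst hδ
      simp only [h, if_true]
      split_ifs
      · exact (Commute.refl r₀).inv_left
      · exact .one_left _
    · simp [hδ]
  · intro α ε h hf
    by_cases hε : ε = e₀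
    · subst hε
      simp only [if_true]
      split_ifs with h' h''
      · simp
      · exact absurd hf (hF α (not_le.1 h').le h''.le)
      · exact h2
    · simp [hε]
  · intro β δ ε
    dsimp only
    split_ifs <;> simp [commutatorElement_one_left, commutatorElement_one_right, Commute.one_left]
  · simpa using h3

/-- Every binary relation on an infinite linear order is coded in a locally finite group of the
same cardinality. -/
theorem exists_locallyFinite_codingSystem {L : Type u} [LinearOrder L] [Infinite L]
    (F : L → L → Prop) :
    ∃ (H : Type u) (_ : Group H), IsLocallyFiniteGroup H ∧ #H = #L ∧
      Nonempty (CodingSystem F H) := by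
  classical
  let W : Type u := {x : L × L × L // x.1 < x.2.1 ∧ ∀ α, x.1 ≤ α → α ≤ x.2.1 → ¬ F x.2.2 α}
  choose p r q t s hp hr ht hc hs using fun x : W =>
    exists_coding_in_perm F x.1.1 x.1.2.1 x.1.2.2 x.2.1 x.2.2
  let K := Equiv.Perm (Fin 4)
  -- Each coordinate in `W` secures one instance of `not_commute_s`. On the coordinates in `L` only
  -- `p` is nontrivial; they make `p` injective, so that the group has size at least `#L`.
  let P : L → (W ⊕ L → K) := fun β =>
    Sum.elim (fun x => p x β) (fun l => if l = β then Equiv.swap 0 1 else 1)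
  let E : (W → L → K) → L → (W ⊕ L → K) := fun a α => Sum.elim (fun x => a x α) 1
  let gen : L ⊕ L ⊕ L ⊕ L ⊕ L → (W ⊕ L → K) :=
    Sum.elim P (Sum.elim (E r) (Sum.elim (E q) (Sum.elim (E t) (E s))))
  let H := (FreeGroup.lift gen).range
  have hgen : ∀ i, gen i ∈ H := fun i => ⟨FreeGroup.of i, by simp⟩
  refine ⟨H, inferInstance, isLocallyFiniteGroup_subgroup_pi H, le_antisymm ?_ ?_, ⟨{
    p := fun α => ⟨gen (.inl α), hgen _⟩
    r := fun α => ⟨gen (.inr (.inl α)), hgen _⟩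
    q := fun α => ⟨gen (.inr (.inr (.inl α))), hgen _⟩
    t := fun α => ⟨gen (.inr (.inr (.inr (.inl α)))), hgen _⟩
    s := fun α => ⟨gen (.inr (.inr (.inr (.inr α)))), hgen _⟩
    commute_q_p := ?_
    commute_q_r := ?_
    conj_t := ?_
    commute_t := ?_
    not_commute_s := ?_ }⟩⟩
  · refine (mk_range_le (f := FreeGroup.lift gen)).trans ?_
    simp [add_eq_self (aleph0_le_mk L)]
  · refine mk_le_of_injective (f := fun α => (⟨gen (.inl α), hgen _⟩ : H)) ?_
    intro α β h
    have h' := congrFun (congrArg Subtype.val h) (.inr α)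
    by_contra hne
    simp [gen, P, hne] at h'
    exact (by decide : (Equiv.swap 0 1 : Equiv.Perm (Fin 4)) ≠ 1) h'
  · intro β α h
    refine Subtype.ext (funext ?_)
    rintro (x | l)
    · exact hp x _ _ h
    · simp [gen, E]
  · intro α δ h
    refine Subtype.ext (funext ?_)
    rintro (x | l)
    · exact hr x _ _ h
    · simp [gen, E]
  · intro α ε h hF
    refine Subtype.ext (funext ?_)
    rintro (x | l)
    · exact ht x _ _ h hF
    · simp [gen, E]
  · intro β δ ε h h' hF
    refine Subtype.ext (funext ?_)
    rintro (x | l)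
    · exact hc x β δ ε
    · simp [gen, E]
  · intro β δ ε h h' hF hcomm
    exact hs ⟨(β, δ, ε), h, hF⟩ (congrFun (congrArg Subtype.val hcomm) (.inl _))

/-! ### Clubs of reflecting points. -/

theorem bddAbove_of_mk_lt {κ : Cardinal.{u}} (hreg : κ.IsRegular) {s : Set κ.ord.ToType}
    (hs : #s < κ) : BddAbove s := by
  refine .of_not_isCofinal fun h => (cof_le h).not_gt ?_
  rwa [cof_toType, hreg.cof_ord]

/-- The points closed under a binary function form a club. -/
theorem isClub_closedUnder {κ : Cardinal.{u}} (hreg : κ.IsRegular) (hunc : ℵ₀ < κ)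
    (h : κ.ord.ToType → κ.ord.ToType → κ.ord.ToType) :
    IsClub {c | (∃ x, x < c) ∧ ∀ a < c, ∀ b < c, h a b < c} := by
  constructor
  · intro t ht hne _ c hc
    have hlt : ∀ a < c, ∃ x ∈ t, a < x := fun a ha => (lt_isLUB_iff hc).1 ha
    refine ⟨?_, fun a ha b hb => ?_⟩
    · obtain ⟨x, hx⟩ := hne
      obtain ⟨y, hy⟩ := (ht hx).1
      exact ⟨y, hy.trans_le (hc.1 hx)⟩
    · obtain ⟨x, hx, hax⟩ := hlt (max a b) (max_lt ha hb)
      exact ((ht hx).2 a ((le_max_left a b).trans_lt hax) b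
        ((le_max_right a b).trans_lt hax)).trans_le (hc.1 hx)
  · intro x
    have hbound : ∀ x : κ.ord.ToType, ∃ y, x < y ∧ ∀ a ≤ x, ∀ b ≤ x, h a b < y := by
      intro x
      have hx : #(Set.Iic x) < κ := by
        simpa using mk_Iic_lt x (by simp) (by simpa using hreg.aleph0_le)
      obtain ⟨y, hy⟩ := bddAbove_of_mk_lt hreg
        (s := insert x (Set.range fun p : Set.Iic x × Set.Iic x => h p.1 p.2)) (by
          refine (mk_insert_le).trans_lt (add_lt_of_lt hreg.aleph0_le ?_
            (one_lt_aleph0.trans hunc))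
          exact mk_range_le.trans_lt (by simpa using mul_lt_of_lt hreg.aleph0_le hx hx))
      have : NoMaxOrder κ.ord.ToType := Cardinal.noMaxOrder hreg.aleph0_le
      obtain ⟨z, hz⟩ := exists_gt y
      exact ⟨z, (hy (Set.mem_insert _ _)).trans_lt hz, fun a ha b hb =>
        (hy (Set.mem_insert_of_mem _ ⟨(⟨a, ha⟩, ⟨b, hb⟩), rfl⟩)).trans_lt hz⟩
    choose B hB hB' using hbound
    let s : ℕ → κ.ord.ToType := fun n => B^[n] x
    have hs : ∀ n, s (n + 1) = B (s n) := fun n => Function.iterate_succ_apply' B n x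
    have hmono : Monotone s := monotone_nat_of_le_succ fun n => by rw [hs]; exact (hB _).le
    have hbdd : BddAbove (Set.range s) := bddAbove_of_mk_lt hreg <|
      lt_of_le_of_lt (by simpa using mk_range_le_lift (f := s)) hunc
    -- The least upper bound of the iterates of `B` is closed under `h`, since any two points below
    -- it lie below a common iterate.
    obtain ⟨c, hc, hmin⟩ := WellFounded.has_min (wellFounded_lt (α := κ.ord.ToType)) _ hbdd
    have hcs : ∀ n, s n < c := fun n =>
      (hB (s n)).trans_le (hs n ▸ hc ⟨n + 1, rfl⟩)
    have hlt : ∀ a < c, ∃ n, a < s n := by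
      intro a ha
      by_contra! hn
      exact hmin a (by rintro _ ⟨n, rfl⟩; exact hn n) ha
    refine ⟨c, ⟨⟨x, hcs 0⟩, fun a ha b hb => ?_⟩, (hcs 0).le⟩
    obtain ⟨m, hm⟩ := hlt (max a b) (max_lt ha hb)
    refine (hB' (s m) a (le_max_left a b |>.trans hm.le) b (le_max_right a b |>.trans hm.le)).trans ?_
    exact hs m ▸ hcs (m + 1)

/-- Countably many binary relations reflect on a club: if some element of `T` beyond `a` is
`R i`-related to `b`, then below each point of the club above `a` and `b` there is such an element
whose value under `ρ` is below that point too. -/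
theorem exists_isClub_reflecting {κ : Cardinal.{u}} (hreg : κ.IsRegular) (hunc : ℵ₀ < κ)
    {ι : Type*} [Countable ι] (T : Set κ.ord.ToType) (ρ : κ.ord.ToType → κ.ord.ToType)
    (R : ι → κ.ord.ToType → κ.ord.ToType → Prop) :
    ∃ E : Set κ.ord.ToType, IsClub E ∧ ∀ c ∈ E, ∀ i, (∃ x, x < c) ∧
      ∀ a < c, ∀ b < c, (∃ d ∈ T, a < d ∧ R i b d) →
        ∃ d ∈ T, a < d ∧ d < c ∧ ρ d < c ∧ R i b d := by
  classical
  let h : ι → κ.ord.ToType → κ.ord.ToType → κ.ord.ToType := fun i a b =>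
    if hd : ∃ d ∈ T, a < d ∧ R i b d then max hd.choose (ρ hd.choose) else a
  refine ⟨_, IsClub.iInter_of_countable ?_ fun i => isClub_closedUnder hreg hunc (h i),
    fun c hc i => ?_⟩
  · rw [cof_toType, hreg.cof_ord]
    exact hunc.ne'
  have hc := Set.mem_iInter.1 hc i
  refine ⟨hc.1, fun a ha b hb hd => ?_⟩
  have hlt := hc.2 a ha b hb
  simp only [h, dif_pos hd, max_lt_iff] at hlt
  exact ⟨_, hd.choose_spec.1, hd.choose_spec.2.1, hlt.1, hlt.2, hd.choose_spec.2.2⟩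

/-- The initial segment below `c` reflects the parts of the type of a tuple `x d ∈ V` that concern
`Commute`, over parameters in `V` of rank below `c`. -/
structure ReflectsCommute {L G : Type*} [LinearOrder L] [Group G] (V : Set (G × G × G × G × G))
    (rk : G × G × G × G × G → L) (x : L → G × G × G × G × G) (c : L) : Prop where
  exists_lt : ∃ a, a < c
  reflect : ∀ a < c, (∃ d, x d ∈ V ∧ a < d) → ∃ d, x d ∈ V ∧ a < d ∧ d < c ∧ rk (x d) < c
  reflect_q : ∀ a < c, ∀ y ∈ V, rk y < c →
    (∃ d, x d ∈ V ∧ a < d ∧ Commute (x d).2.2.1 y.1) →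
      ∃ d, x d ∈ V ∧ a < d ∧ d < c ∧ rk (x d) < c ∧ Commute (x d).2.2.1 y.1
  reflect_r : ∀ a < c, ∀ y ∈ V, rk y < c →
    (∃ d, x d ∈ V ∧ a < d ∧ Commute y.2.2.1 (x d).2.1) →
      ∃ d, x d ∈ V ∧ a < d ∧ d < c ∧ rk (x d) < c ∧ Commute y.2.2.1 (x d).2.1

/-- Injectivity of `rk` on `V` lets elements of `κ` name the parameters, so the commutation
conditions become binary relations on `κ`. -/
theorem exists_isClub_reflectsCommute {κ : Cardinal.{u}} (hreg : κ.IsRegular) (hunc : ℵ₀ < κ)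
    {G : Type*} [Group G] {V : Set (G × G × G × G × G)} {rk : G × G × G × G × G → κ.ord.ToType}
    (hrk : Set.InjOn rk V) (x : κ.ord.ToType → G × G × G × G × G) :
    ∃ E : Set κ.ord.ToType, IsClub E ∧ ∀ c ∈ E, ReflectsCommute V rk x c := by
  obtain ⟨E, hE, h⟩ := exists_isClub_reflecting hreg hunc {d | x d ∈ V} (fun d => rk (x d))
    (![fun _ _ => True, fun b d => ∃ y ∈ V, rk y = b ∧ Commute (x d).2.2.1 y.1,
      fun b d => ∃ y ∈ V, rk y = b ∧ Commute y.2.2.1 (x d).2.1] : Fin 3 → _ → _ → Prop)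
  refine ⟨E, hE, fun c hc => ⟨(h c hc 0).1, fun a ha hd => ?_, fun a ha y hy hyc hd => ?_,
    fun a ha y hy hyc hd => ?_⟩⟩
  · obtain ⟨d, hd, had⟩ := hd
    obtain ⟨d, h1, h2, h3, h4, -⟩ := (h c hc 0).2 a ha a ha ⟨d, hd, had, trivial⟩
    exact ⟨d, h1, h2, h3, h4⟩
  · obtain ⟨d, hd, had, hcomm⟩ := hd
    obtain ⟨d, h1, h2, h3, h4, z, hz, hzy, h5⟩ :=
      (h c hc 1).2 a ha _ hyc ⟨d, hd, had, y, hy, rfl, hcomm⟩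
    obtain rfl := hrk hz hy hzy
    exact ⟨d, h1, h2, h3, h4, h5⟩
  · obtain ⟨d, hd, had, hcomm⟩ := hd
    obtain ⟨d, h1, h2, h3, h4, z, hz, hzy, h5⟩ :=
      (h c hc 2).2 a ha _ hyc ⟨d, hd, had, y, hy, rfl, hcomm⟩
    obtain rfl := hrk hz hy hzy
    exact ⟨d, h1, h2, h3, h4, h5⟩

/-! ### Incompatibility of opposite codes. -/

/-- Two coding systems in one group that agree at `e` cannot code opposite values on a final
segment of a point below which both reflect. -/
theorem CodingSystem.false_of_reflectsCommute {L G : Type*} [LinearOrder L] [Group G]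
    {F₁ F₂ : L → L → Prop} (x₁ : CodingSystem F₁ G) (x₂ : CodingSystem F₂ G)
    {V : Set (G × G × G × G × G)} {rk : G × G × G × G × G → L} {b c e : L} (hbc : b < c)
    (hce : c ≤ e) (h₁ : ReflectsCommute V rk x₁.tuple c) (h₂ : ReflectsCommute V rk x₂.tuple c)
    (hV : x₁.tuple e ∈ V) (heq : x₁.tuple e = x₂.tuple e)
    (hF₁ : ∀ a, b < a → a < c → ¬ F₁ e a) (hF₂ : ∀ a, b < a → a < c → F₂ e a) : False := by
  have hr : x₁.r e = x₂.r e := congrArg (fun y => y.2.1) heq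
  have hq : x₁.q e = x₂.q e := congrArg (fun y => y.2.2.1) heq
  have ht : x₁.t e = x₂.t e := congrArg (fun y => y.2.2.2.1) heq
  have hs : x₁.s e = x₂.s e := congrArg (fun y => y.2.2.2.2) heq
  -- In each of the three reflections `e` itself is the witness to be pulled below `c`; equality of
  -- the tuples at `e` turns relations inside one system into relations between the two.
  obtain ⟨u, huV, hbu, huc, hur⟩ := h₁.reflect b hbc ⟨e, hV, hbc.trans_le hce⟩
  obtain ⟨v, hvV, hbv, hvc, hvr, hvu⟩ := h₂.reflect_q b hbc _ huV hur
    ⟨e, heq ▸ hV, hbc.trans_le hce, by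
      have := x₁.commute_q_p (huc.trans_le hce)
      rwa [hq] at this⟩
  obtain ⟨w, -, huw, hwc, -, hvw⟩ := h₁.reflect_r u huc _ hvV hvr
    ⟨e, hV, huc.trans_le hce, by
      have := x₂.commute_q_r (hvc.trans_le hce)
      rwa [← hr] at this⟩
  replace hvu : Commute (x₂.q v) (x₁.p u) := hvu
  replace hvw : Commute (x₂.q v) (x₁.r w) := hvw
  have hconst : ∀ a, u ≤ a → a ≤ w → ¬ F₁ e a := fun a ha ha' =>
    hF₁ a (hbu.trans_le ha) (ha'.trans_lt hwc)
  refine x₁.not_commute_s huw (hwc.trans_le hce) hconst ?_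
  have hcomm := x₁.commute_t huw (hwc.trans_le hce) hconst
  have hconj := x₂.conj_t (hvc.trans_le hce) (hF₂ v hbv hvc)
  have hfix : x₂.q v * ⁅x₁.p u, x₁.r w⁆ * (x₂.q v)⁻¹ = ⁅x₁.p u, x₁.r w⁆ := by
    rw [conjugate_commutatorElement, hvu.eq, hvw.eq, mul_inv_cancel_right, mul_inv_cancel_right]
  rw [hs, ← hconj, ← hfix, ← ht]
  exact (Commute.conj_iff _).2 hcomm

/-- A non-accumulation point that is not minimal has a predecessor in a weak sense. -/
theorem exists_gap_of_mem_nacc {L : Type u} [LinearOrder L] {C : Set L} {c : L} (hc : c ∈ nacc C)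
    (hmin : ∃ a, a < c) : ∃ b < c, ∀ a ∈ C, b < a → c ≤ a := by
  by_cases hlim : IsSuccLimit c
  · have := hc.2
    push Not at this
    obtain ⟨b, hb, h⟩ := this hlim
    exact ⟨b, hb, h⟩
  · obtain ⟨a, ha⟩ := hmin
    have : ¬ IsSuccPrelimit c := fun h => hlim ⟨not_isMin_of_lt ha, h⟩
    obtain ⟨b, hb⟩ := not_isSuccPrelimit_iff.1 this
    exact ⟨b, hb.lt, fun a _ hba => hb.ge_of_gt hba⟩

/-! ### The coded relations and the families catching tuples. -/

namespace QrOneWitness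

variable {χ₂ χ₁ κ : Cardinal.{u}} (W : QrOneWitness χ₂ χ₁ κ)

/-- For `δ ∈ S`, the value of `g_{j,δ}` at the least element of `C_δ` above `α` is `1`. -/
def codes (j : χ₂.ord.ToType) (δ α : κ.ord.ToType) : Prop :=
  ∃ (hδ : δ ∈ W.S) (γ : W.C ⟨δ, hδ⟩), α < γ.1 ∧ (∀ ξ ∈ W.C ⟨δ, hδ⟩, α < ξ → γ.1 ≤ ξ) ∧
    W.g j ⟨δ, hδ⟩ γ = 1

/-- As no point of `C δ` lies strictly between `b` and `γ`, the coded bit is constant on that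
interval. -/
theorem codes_iff {j : χ₂.ord.ToType} {δ : W.S} {γ : W.C δ} {b a : κ.ord.ToType}
    (hgap : ∀ ξ ∈ W.C δ, b < ξ → γ.1 ≤ ξ) (hba : b < a) (ha : a < γ.1) :
    W.codes j δ.1 a ↔ W.g j δ γ = 1 := by
  constructor
  · rintro ⟨hδ, γ', haγ', hmin, hg⟩
    have : γ' = γ := Subtype.ext
      (le_antisymm (hmin _ γ.2 ha) (hgap _ γ'.2 (hba.trans haγ')))
    rwa [this] at hg
  · exact fun hg => ⟨δ.2, γ, ha, fun ξ hξ haξ => hgap ξ hξ (hba.trans haξ), hg⟩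

/-- For `χ₁ = κ` the whole of `χ₁` is small enough to be the only member. Otherwise a family
realizing `U_I(χ₁)` catches `f` on a positive set, which must meet the set of good guesses because
the complement of the latter lies in `I`. -/
theorem exists_family (hκχ : κ ≤ χ₁) (hχ : χ₁ < χ₂) (hκ : ℵ₀ < κ) :
    ∃ P : Set (Set χ₁.ord.ToType), #P < χ₂ ∧ (∀ v ∈ P, #v ≤ κ) ∧
      ∀ (j : χ₂.ord.ToType) (f : W.S → χ₁.ord.ToType), ∃ v ∈ P, ∀ E, IsClub E →
        ∃ δ : W.S, f δ ∈ v ∧ nacc (W.C δ) ∩ E ∈ W.𝒜 j δ := by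
  by_cases hne : χ₁ = κ
  · refine ⟨{Set.univ}, ?_, ?_, fun j f => ⟨Set.univ, rfl, fun E hE => ?_⟩⟩
    · simpa using one_lt_aleph0.trans (hκ.trans_le (hκχ.trans hχ.le))
    · simp [hne]
    · obtain ⟨Y, hY, -, h⟩ := W.guess j E hE
      obtain ⟨δ, hδ⟩ : Y.Nonempty := by
        rw [Set.nonempty_iff_ne_empty]
        rintro rfl
        exact hY (W.I.bot_mem)
      exact ⟨δ, trivial, h δ hδ⟩
  · have hu : uNumber W.I χ₁.ord.ToType < χ₂ := W.u_lt.resolve_left (fun h => hne h.1) |>.2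
    by_cases hJ : Nonempty χ₂.ord.ToType
    swap
    · exact ⟨∅, by simpa using (zero_le).trans_lt hχ, by simp, fun j => (hJ ⟨j⟩).elim⟩
    obtain ⟨j₀⟩ := hJ
    have huniv : (Set.univ : Set W.S) ∉ W.I := by
      obtain ⟨Y, hY, -⟩ := W.guess j₀ Set.univ .univ
      exact fun h => hY (W.I.lower (Set.subset_univ Y) h)
    obtain ⟨P, hP, hcard, hpos⟩ := csInf_mem (s := {c | ∃ P : Set (Set χ₁.ord.ToType), #P = c ∧
        (∀ v ∈ P, #v ≤ #W.S) ∧ ∀ f : W.S → χ₁.ord.ToType, ∃ v ∈ P, {a | f a ∈ v} ∉ W.I})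
      ⟨_, {v | #v ≤ #W.S}, rfl, fun v hv => hv,
        fun f => ⟨Set.range f, mk_range_le, by simpa using huniv⟩⟩
    refine ⟨P, hP.trans_lt hu, fun v hv => (hcard v hv).trans ?_, fun j f => ?_⟩
    · simpa using mk_set_le W.S
    · obtain ⟨v, hv, hf⟩ := hpos f
      refine ⟨v, hv, fun E hE => ?_⟩
      obtain ⟨Y, -, hY, h⟩ := W.guess j E hE
      by_contra! hno
      exact hf (W.I.lower (fun δ hδ hδY => hno δ hδ (h δ hδY)) (hY hne))

end QrOneWitness

theorem mainTheorem5 (χ₂ χ₁ κ : Cardinal.{u}) (hreg : κ.IsRegular) (hunc : ℵ₀ < κ)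
    (hκχ : κ ≤ χ₁) (hχ : χ₁ < χ₂) (hQr : QrOne χ₂ χ₁ κ) :
    ¬ ∃ (a : Ordinal.{u}) (_ : a < χ₂.ord) (G : a.ToType → Type u)
        (_ : ∀ i, Group (G i)),
        (∀ i, #(G i) ≤ χ₁) ∧
        ∀ (H : Type u) [Group H], IsLocallyFiniteGroup H → #H = κ →
          ∃ (i : a.ToType) (f : H →* G i), Function.Injective f := by
  classical
  obtain ⟨W⟩ := hQr
  rintro ⟨a, ha, G, hG, hcard, huniv⟩
  have hχ₁ : ℵ₀ ≤ χ₁ := hreg.aleph0_le.trans hκχ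
  have hχ₂ : ℵ₀ ≤ χ₂ := hχ₁.trans hχ.le
  have hinf : Infinite κ.ord.ToType := by
    rw [infinite_iff]; simpa using hreg.aleph0_le
  have hnonempty : Nonempty κ.ord.ToType := inferInstance
  have hsys : ∀ j, ∃ i, Nonempty (CodingSystem (W.codes j) (G i)) := by
    intro j
    obtain ⟨H, _, hlf, hH, ⟨x⟩⟩ := exists_locallyFinite_codingSystem (W.codes j)
    obtain ⟨i, f, hf⟩ := huniv H hlf (by simpa using hH)
    exact ⟨i, ⟨x.map f hf⟩⟩
  have hcode : ∀ i, Nonempty ((G i × G i × G i × G i × G i) ↪ χ₁.ord.ToType) := by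
    intro i
    rw [← Cardinal.le_def]
    have hmul : ∀ {c : Cardinal.{u}}, c ≤ χ₁ → #(G i) * c ≤ χ₁ := fun h =>
      (mul_le_mul' (hcard i) h).trans (mul_eq_self hχ₁).le
    simpa using hmul (hmul (hmul (hmul (hcard i))))
  have code := fun i => (hcode i).some
  obtain ⟨P, hP, hPcard, hfam⟩ := W.exists_family hκχ hχ hunc
  have hρ : ∀ v : P, Nonempty (v.1 ↪ κ.ord.ToType) := fun v => by
    rw [← Cardinal.le_def]
    simpa using hPcard v.1 v.2
  have ρ := fun v => (hρ v).some
  let V : ∀ i, P → Set (G i × G i × G i × G i × G i) := fun i v => {y | code i y ∈ v.1}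
  let rk : ∀ i, P → G i × G i × G i × G i × G i → κ.ord.ToType := fun i v y =>
    if h : code i y ∈ v.1 then ρ v ⟨_, h⟩ else Classical.arbitrary _
  have hrk : ∀ i v, Set.InjOn (rk i v) (V i v) := by
    intro i v y hy z hz h
    simp only [V, Set.mem_ofPred_eq] at hy hz
    simp only [rk, dif_pos hy, dif_pos hz] at h
    exact (code i).injective (congrArg Subtype.val ((ρ v).injective h))
  -- A key records the group, the set `v` with the code of the tuple at `δ` in it, and `δ`.
  -- Recording `v` makes `V` and `rk` the same for both systems.
  let Key := a.ToType × (Σ v : P, v.1) × W.S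
  have hKey : #Key < χ₂ := by
    have h1 : #a.ToType < χ₂ := by simpa using lt_ord.1 ha
    have h2 : #(Σ v : P, v.1) < χ₂ := by
      rw [mk_sigma]
      refine (sum_le_sum _ (fun _ : P => κ) fun v : P => hPcard v.1 v.2).trans_lt ?_
      simpa using mul_lt_of_lt hχ₂ hP (hκχ.trans_lt hχ)
    have h3 : #W.S < χ₂ := (mk_set_le W.S).trans_lt (by simpa using hκχ.trans_lt hχ)
    simpa [Key] using mul_lt_of_lt hχ₂ h1 (mul_lt_of_lt hχ₂ h2 h3)
  have hkey : ∀ j, ∃ k : Key, ∃ x : CodingSystem (W.codes j) (G k.1),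
      code k.1 (x.tuple k.2.2.1) = k.2.1.2 ∧ ∃ E,
        (∀ c ∈ E, ReflectsCommute (V k.1 k.2.1.1) (rk k.1 k.2.1.1) x.tuple c) ∧
        nacc (W.C k.2.2) ∩ E ∈ W.𝒜 j k.2.2 := by
    intro j
    obtain ⟨i, ⟨x⟩⟩ := hsys j
    obtain ⟨v, hv, h⟩ := hfam j fun δ => code i (x.tuple δ.1)
    obtain ⟨E, hE, hE'⟩ := exists_isClub_reflectsCommute hreg hunc (hrk i ⟨v, hv⟩) x.tuple
    obtain ⟨δ, hδ, hA⟩ := h E hE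
    exact ⟨(i, ⟨⟨v, hv⟩, ⟨_, hδ⟩⟩, δ), x, rfl, E, hE', hA⟩
  choose key hkey using hkey
  have hnot : ¬ Function.Injective key := fun hinj => by
    have := mk_le_of_injective hinj
    rw [mk_toType, card_ord] at this
    exact this.not_gt hKey
  obtain ⟨j₁, j₂, heq, hne⟩ := Function.not_injective_iff.1 hnot
  obtain ⟨x₁, hx₁, E₁, hE₁, hA₁⟩ := hkey j₁
  have hk₂ := hkey j₂
  rw [← heq] at hk₂
  obtain ⟨x₂, hx₂, E₂, hE₂, hA₂⟩ := hk₂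
  generalize key j₁ = k at *
  obtain ⟨i, ⟨v, y⟩, δ⟩ := k
  dsimp only at *
  obtain ⟨γ, ⟨hγ₁, hγ₂⟩, hg⟩ := W.differ j₁ j₂ hne δ _ hA₁ _ hA₂
  have hr₁ := hE₁ _ hγ₁.2
  have hr₂ := hE₂ _ hγ₂.2
  obtain ⟨b, hb, hgap⟩ := exists_gap_of_mem_nacc hγ₁.1 hr₁.exists_lt
  have htup : x₁.tuple δ.1 = x₂.tuple δ.1 := (code i).injective (hx₁.trans hx₂.symm)
  have hV : x₁.tuple δ.1 ∈ V i v := by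
    simp only [V, Set.mem_ofPred_eq, hx₁]
    exact y.2
  have hγδ := (W.C_lt δ γ.1 γ.2).le
  have hcodes : ∀ j a, b < a → a < γ.1 → (W.codes j δ.1 a ↔ W.g j δ γ = 1) :=
    fun j a => W.codes_iff hgap
  -- The system with bit 0 supplies `p` and `r`, the one with bit 1 supplies `q`.
  by_cases h₁ : W.g j₁ δ γ = 1
  · have h₂ : W.g j₂ δ γ ≠ 1 := fun h => hg (h₁.trans h.symm)
    exact x₂.false_of_reflectsCommute x₁ hb hγδ hr₂ hr₁ (htup ▸ hV) htup.symm
      (fun a h h' => (hcodes j₂ a h h').not.2 h₂) fun a h h' => (hcodes j₁ a h h').2 h₁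
  · have h₂ : W.g j₂ δ γ = 1 := by omega
    exact x₁.false_of_reflectsCommute x₂ hb hγδ hr₁ hr₂ hV htup
      (fun a h h' => (hcodes j₁ a h h').not.2 h₁) fun a h h' => (hcodes j₂ a h h').2 h₂
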